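/- A bivariate copula is a function $C\colon[0,1]^2\to[0,1]$ that is the restriction to $[0,1]^2$ of the distribution function of a probability measure on $[0,1]^2$ with uniform marginals; equivalently, $C(u,0)=C(0,v)=0$, $C(u,1)=u$, $C(1,v)=v$ for all $u,v\in[0,1]$, and $C(u_2,v_2)-C(u_2,v_1)-C(u_1,v_2)+C(u_1,v_1)\ge 0$ whenever $0\le u_1\le u_2\le 1$ and $0\le v_1\le v_2\le 1$. Let $\partial_2 C$ denote its partial derivative with respect to the second component; for each $u\in[0,1]$, $\partial_2C(u,t)$ exists for Lebesgue-almost every $t\in(0,1)$. Let $\Pi(u,v)=uv$, and define the upper product of copulas $D,E$ and the upper product transform by $$(D\vee E)(u,v)=\int_0^1\min\{\partial_2D(u,t),\partial_2E(v,t)\}\,dt,\qquad \mathcal T(C)=C\vee\Pi,\qquad \mathcal T^2=\mathcal T\circ\mathcal T .$$ Write $D\le_{lo}E$ if $D(u,v)\le E(u,v)$ for all $(u,v)\in[0,1]^2$. For a measurable $f\colon(0,1)\to[0,1]$, let $f^*$ be its decreasing rearrangement, i.e. the (essentially unique) decreasing function on $(0,1)$ with $\lambda(f^*\le y)=\lambda(f\le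 y)$ for all $y\in[0,1]$, where $\lambda$ is Lebesgue measure; explicitly $f^*(t)=\inf\{y\ge 0:\lambda(\{s\in(0,1): f(s)>y\})\le t\}$. Write $f\prec_S g$ if $\int_0^v f^*(t)\,dt\le\int_0^v g^*(t)\,dt$ for all $v\in(0,1)$, with equality for $v=1$. Write $D\le_{\partial_2S}E$ if $\partial_2D(v,\cdot)\prec_S\partial_2E(v,\cdot)$ for all $v\in(0,1)$. As usual, $\ge_{lo}$ and $\ge_{\partial_2S}$ denote the reversed relations. **Theorem.** Let $D$ and $E$ be bivariate copulas. Then the following statements are equivalent: 1. $D\le_{\partial_2S}E$; 2. $\mathcal T(D)\ge_{lo}\mathcal T(E)$; 3. $\mathcal T(D)\ge_{\partial_2S}\mathcal T(E)$; 4. $\mathcal T^2(D)\le_{lo}\mathcal T^2(E)$; 5. $\mathcal T^2(D)\le_{\partial_2S}\mathcal T^2(E)$. -/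

import Mathlib

open MeasureTheory

noncomputable section

/-- A bivariate copula: a distribution function on `[0,1]²` with standard uniform marginals, i.e. a
grounded and 2-increasing function with uniform margins. It is represented by a function on `ℝ²`,
of which only the values on the unit square are relevant. -/
structure IsCopula (C : ℝ → ℝ → ℝ) : Prop where
  zero_left : ∀ v ∈ Set.Icc (0 : ℝ) 1, C 0 v = 0
  zero_right : ∀ u ∈ Set.Icc (0 : ℝ) 1, C u 0 = 0
  one_left : ∀ v ∈ Set.Icc (0 : ℝ) 1, C 1 v = v
  one_right : ∀ u ∈ Set.Icc (0 : ℝ) 1, C u 1 = u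
  two_increasing : ∀ u₁ ∈ Set.Icc (0 : ℝ) 1, ∀ u₂ ∈ Set.Icc (0 : ℝ) 1,
    ∀ v₁ ∈ Set.Icc (0 : ℝ) 1, ∀ v₂ ∈ Set.Icc (0 : ℝ) 1, u₁ ≤ u₂ → v₁ ≤ v₂ →
      0 ≤ C u₂ v₂ - C u₂ v₁ - C u₁ v₂ + C u₁ v₁

/-- The derivative `∂₂C(u,t)` with respect to the second component. For a copula it exists for
almost every `t ∈ (0,1)`; at the exceptional points it is set to `0`. -/
def partialTwo (C : ℝ → ℝ → ℝ) (u t : ℝ) : ℝ := deriv (C u) t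

/-- The independence copula `Π(u,v) = uv`. -/
def indepCopula (u v : ℝ) : ℝ := u * v

/-- The upper product `(D ∨ E)(u,v) = ∫₀¹ min{∂₂D(u,t), ∂₂E(v,t)} dt`. -/
def upperProduct (D E : ℝ → ℝ → ℝ) (u v : ℝ) : ℝ :=
  ∫ t in (0 : ℝ)..1, min (partialTwo D u t) (partialTwo E v t)

/-- The upper product transform `T(C) = C ∨ Π`. -/
def upperTransform (C : ℝ → ℝ → ℝ) : ℝ → ℝ → ℝ := upperProduct C indepCopula

/-- The lower orthant order, i.e. the pointwise order on `[0,1]²`. -/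
def LowerOrthantLE (D E : ℝ → ℝ → ℝ) : Prop :=
  ∀ u ∈ Set.Icc (0 : ℝ) 1, ∀ v ∈ Set.Icc (0 : ℝ) 1, D u v ≤ E u v

/-- The decreasing rearrangement `f*(t) = inf {y ≥ 0 | λ{s ∈ (0,1) | f(s) > y} ≤ t}` of a
measurable function `f : (0,1) → [0,1]`. -/
def decRearrangement (f : ℝ → ℝ) (t : ℝ) : ℝ :=
  sInf {y : ℝ | 0 ≤ y ∧ volume.real {s ∈ Set.Ioo (0 : ℝ) 1 | y < f s} ≤ t}

/-- The Schur order `f ≺_S g` of measurable functions `(0,1) → [0,1]`. -/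
def SchurLE (f g : ℝ → ℝ) : Prop :=
  (∀ v ∈ Set.Ioo (0 : ℝ) 1,
    ∫ t in (0 : ℝ)..v, decRearrangement f t ≤ ∫ t in (0 : ℝ)..v, decRearrangement g t) ∧
  ∫ t in (0 : ℝ)..1, decRearrangement f t = ∫ t in (0 : ℝ)..1, decRearrangement g t

/-- The Schur order for copula derivatives with respect to the second component. -/
def DerivSchurLE (D E : ℝ → ℝ → ℝ) : Prop :=
  ∀ v ∈ Set.Ioo (0 : ℝ) 1, SchurLE (partialTwo D v) (partialTwo E v)

end

/-- The explicit formula does give the rearrangement: `f*` is decreasing on `(0,1)` and has the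
same distribution as `f`, which determines it almost everywhere. -/
theorem decRearrangement_spec (f : ℝ → ℝ) (hf : Measurable f)
    (hf1 : ∀ s ∈ Set.Ioo (0 : ℝ) 1, f s ∈ Set.Icc (0 : ℝ) 1) :
    AntitoneOn (decRearrangement f) (Set.Ioo 0 1) ∧
    ∀ y ∈ Set.Icc (0 : ℝ) 1, volume {t ∈ Set.Ioo (0 : ℝ) 1 | decRearrangement f t ≤ y} =
      volume {t ∈ Set.Ioo (0 : ℝ) 1 | f t ≤ y} := by
  have hfin : ∀ p : ℝ → Prop, volume {s ∈ Set.Ioo (0 : ℝ) 1 | p s} ≠ ⊤ := fun p =>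
    measure_ne_top_of_subset (Set.sep_subset _ _) (by simp)
  have hbdd : ∀ t : ℝ, BddBelow
      {y : ℝ | 0 ≤ y ∧ volume.real {s ∈ Set.Ioo (0 : ℝ) 1 | y < f s} ≤ t} :=
    fun t => ⟨0, fun y hy => hy.1⟩
  have hne : ∀ t : ℝ, 0 ≤ t →
      {y : ℝ | 0 ≤ y ∧ volume.real {s ∈ Set.Ioo (0 : ℝ) 1 | y < f s} ≤ t}.Nonempty := by
    intro t ht
    refine ⟨1, zero_le_one, ?_⟩
    have : {s ∈ Set.Ioo (0 : ℝ) 1 | 1 < f s} = ∅ := by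
      ext s
      simp only [Set.mem_ofPred_eq, Set.mem_empty_iff_false, iff_false, not_and, not_lt]
      exact fun hs => (hf1 s hs).2
    rw [this]
    simpa using ht
  have key : ∀ t : ℝ, 0 ≤ t → ∀ y : ℝ, 0 ≤ y → (decRearrangement f t ≤ y ↔
      volume.real {s ∈ Set.Ioo (0 : ℝ) 1 | y < f s} ≤ t) := by
    intro t ht y hy
    refine ⟨fun h => ?_, fun h => csInf_le (hbdd t) ⟨hy, h⟩⟩
    have hU : {s ∈ Set.Ioo (0 : ℝ) 1 | y < f s} =
        ⋃ n : ℕ, {s ∈ Set.Ioo (0 : ℝ) 1 | y + 1 / ((n : ℝ) + 1) < f s} := by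
      ext s
      simp only [Set.mem_ofPred_eq, Set.mem_iUnion]
      constructor
      · rintro ⟨hs, h1⟩
        obtain ⟨n, hn⟩ := exists_nat_one_div_lt (sub_pos.mpr h1)
        exact ⟨n, hs, by linarith⟩
      · rintro ⟨n, hs, h1⟩
        have : (0 : ℝ) < 1 / ((n : ℝ) + 1) := by positivity
        exact ⟨hs, by linarith⟩
    have hmono : Monotone
        (fun n : ℕ => {s ∈ Set.Ioo (0 : ℝ) 1 | y + 1 / ((n : ℝ) + 1) < f s}) := by
      intro m n hmn s hs
      refine ⟨hs.1, lt_of_le_of_lt ?_ hs.2⟩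
      have := Nat.one_div_le_one_div (α := ℝ) hmn
      linarith
    rw [measureReal_def, hU, hmono.measure_iUnion]
    refine ENNReal.toReal_le_of_le_ofReal ht (iSup_le fun n => ?_)
    rw [ENNReal.le_ofReal_iff_toReal_le (hfin _) ht]
    have hpos : (0 : ℝ) < 1 / ((n : ℝ) + 1) := by positivity
    obtain ⟨z, hz, hzy⟩ := exists_lt_of_csInf_lt (hne t ht)
      (lt_of_le_of_lt h (lt_add_of_pos_right y hpos))
    refine le_trans (measureReal_mono ?_ (hfin _)) hz.2
    exact fun s hs => ⟨hs.1, hzy.trans hs.2⟩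
  refine ⟨?_, ?_⟩
  · intro a ha b _ hab
    exact csInf_le_csInf (hbdd b) (hne a ha.1.le) fun y hy => ⟨hy.1, hy.2.trans hab⟩
  · intro y hy
    set m := volume.real {s ∈ Set.Ioo (0 : ℝ) 1 | y < f s} with hm
    have h0 : 0 ≤ m := measureReal_nonneg
    have hset : {t ∈ Set.Ioo (0 : ℝ) 1 | f t ≤ y} =
        Set.Ioo (0 : ℝ) 1 \ {s ∈ Set.Ioo (0 : ℝ) 1 | y < f s} := by
      ext s
      simp only [Set.mem_ofPred_eq, Set.mem_sdiff, not_and, not_lt]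
      exact ⟨fun h => ⟨h.1, fun _ => h.2⟩, fun h => ⟨h.1, h.2 h.1⟩⟩
    have hmeas : MeasurableSet {s ∈ Set.Ioo (0 : ℝ) 1 | y < f s} :=
      measurableSet_Ioo.inter (measurableSet_lt measurable_const hf)
    have hR : volume {t ∈ Set.Ioo (0 : ℝ) 1 | f t ≤ y} = ENNReal.ofReal (1 - m) := by
      rw [hset, measure_sdiff (Set.sep_subset _ _) hmeas.nullMeasurableSet (hfin _),
        Real.volume_Ioo, sub_zero, ENNReal.ofReal_sub _ h0, hm, measureReal_def,
        ENNReal.ofReal_toReal (hfin _)]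
    rw [hR]
    refine le_antisymm ?_ ?_
    · rw [← Real.volume_Icc]
      refine measure_mono fun t ht => ⟨(key t ht.1.1.le y hy.1).1 ht.2, ht.1.2.le⟩
    · rw [← Real.volume_Ioo]
      refine measure_mono fun t ht => ?_
      have ht0 : 0 < t := lt_of_le_of_lt h0 ht.1
      exact ⟨⟨ht0, ht.2⟩, (key t ht0.le y hy.1).2 ht.1.le⟩

/-! By the layer cake formula, `∫₀¹ min (f t) v dt = ∫₀ᵛ λ {f > y} dy` for `f : (0,1) → [0,1]`, so
`T(C)(u, ·)` is the primitive of the survival function of `∂₂C(u, ·)`. Hence `∂₂T(C)(u, ·)` is a.e.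
equal to a decreasing function and to its own rearrangement: between transforms, the derivative
Schur order is the pointwise order. For arbitrary sections, majorization of `f*` by `g*` is dual to
the reversed pointwise order of `v ↦ ∫₀¹ min (f t) v dt` and `v ↦ ∫₀¹ min (g t) v dt`, which are the
sections of the transforms. So `D ≤_∂₂S E` amounts to `T(D) ≥_lo T(E)`, and the latter to
`T(D) ≥_∂₂S T(E)`; repeating this with `T(D)` and `T(E)` reverses the order once more. -/

open Set
open ProbabilityTheory (IdentDistrib)

theorem forall_mem_Icc_iff_forall_mem_Ioo {α : Type*} [PartialOrder α] {a b : α} {P : α → Prop}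
    (ha : P a) (hb : P b) : (∀ x ∈ Icc a b, P x) ↔ ∀ x ∈ Ioo a b, P x := by
  refine ⟨fun h x hx => h x (Ioo_subset_Icc_self hx), fun h x hx => ?_⟩
  rcases eq_endpoints_or_mem_Ioo_of_mem_Icc hx with rfl | rfl | hx
  exacts [ha, hb, h x hx]

theorem intervalIntegral_eq_setIntegral_Ioo (f : ℝ → ℝ) {a b : ℝ} (hab : a ≤ b) :
    ∫ t in a..b, f t = ∫ t in Ioo a b, f t := by
  rw [intervalIntegral.integral_of_le hab, integral_Ioc_eq_integral_Ioo]

theorem integral_min_const_eq_integral_measureReal_lt {α : Type*} [MeasurableSpace α]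
    {μ : Measure α} [IsFiniteMeasure μ] {f : α → ℝ} (hf : AEMeasurable f μ) (h0 : 0 ≤ᵐ[μ] f)
    {v : ℝ} (hv : 0 ≤ v) :
    ∫ x, min (f x) v ∂μ = ∫ y in (0 : ℝ)..v, μ.real {x | y < f x} := by
  have hmin0 : 0 ≤ᵐ[μ] fun x => min (f x) v := h0.mono fun x hx => le_min hx hv
  have hminv : (fun x => min (f x) v) ≤ᵐ[μ] fun _ => v := .of_forall fun x => min_le_right _ _
  have hint : Integrable (fun x => min (f x) v) μ :=
    .of_mem_Icc 0 v (hf.min aemeasurable_const) (hmin0.and hminv)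
  rw [hint.integral_eq_integral_Ioc_meas_le hmin0 hminv, intervalIntegral.integral_of_le hv]
  refine setIntegral_congr_ae measurableSet_Ioc ?_
  filter_upwards [meas_le_ae_eq_meas_lt μ volume f] with y hy hyv
  simp only [measureReal_def, le_min_iff, hyv.2, and_true, hy]

section Majorization

variable {a b s v : ℝ} {f g : ℝ → ℝ}

theorem forall_mem_Icc_integral_le_iff_forall_mem_Ioo
    (hfg : ∫ t in a..b, f t = ∫ t in a..b, g t) :
    (∀ s ∈ Icc a b, ∫ t in a..s, f t ≤ ∫ t in a..s, g t) ↔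
      ∀ s ∈ Ioo a b, ∫ t in a..s, f t ≤ ∫ t in a..s, g t :=
  forall_mem_Icc_iff_forall_mem_Ioo (P := fun s => ∫ t in a..s, f t ≤ ∫ t in a..s, g t)
    (by simp only [intervalIntegral.integral_same, le_refl]) hfg.le

theorem head_integral_le_iff_tail_integral_le (hf : IntervalIntegrable f volume a b)
    (hg : IntervalIntegrable g volume a b) (hs : s ∈ Icc a b)
    (hfg : ∫ t in a..b, f t = ∫ t in a..b, g t) :
    ∫ t in a..s, f t ≤ ∫ t in a..s, g t ↔ ∫ t in s..b, g t ≤ ∫ t in s..b, f t := by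
  have hs' : s ∈ uIcc a b := Icc_subset_uIcc hs
  have split {k : ℝ → ℝ} (hk : IntervalIntegrable k volume a b) :=
    intervalIntegral.integral_add_adjacent_intervals
      (hk.mono_set (uIcc_subset_uIcc_left hs')) (hk.mono_set (uIcc_subset_uIcc_right hs'))
  rw [← split hf, ← split hg] at hfg
  constructor <;> intro h <;> linarith

theorem intervalIntegrable_min_const (hf : IntervalIntegrable f volume a b) (v : ℝ) :
    IntervalIntegrable (fun t => min (f t) v) volume a b :=
  have hv : IntervalIntegrable (fun _ => v) volume a b := intervalIntegrable_const
  ⟨hf.1.inf hv.1, hf.2.inf hv.2⟩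

theorem integral_min_const_le (hf : IntervalIntegrable f volume a b) (hs : s ∈ Icc a b) (v : ℝ) :
    ∫ t in a..b, min (f t) v ≤ v * (s - a) + ∫ t in s..b, f t := by
  have hmin := intervalIntegrable_min_const hf v
  have hs' : s ∈ uIcc a b := Icc_subset_uIcc hs
  have hmin_as := hmin.mono_set (uIcc_subset_uIcc_left hs')
  have hmin_sb := hmin.mono_set (uIcc_subset_uIcc_right hs')
  have hf_sb := hf.mono_set (uIcc_subset_uIcc_right hs')
  calc ∫ t in a..b, min (f t) v
      = (∫ t in a..s, min (f t) v) + ∫ t in s..b, min (f t) v :=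
        (intervalIntegral.integral_add_adjacent_intervals hmin_as hmin_sb).symm
    _ ≤ (∫ _ in a..s, v) + ∫ t in s..b, f t := add_le_add
        (intervalIntegral.integral_mono_on hs.1 hmin_as intervalIntegrable_const
          fun t _ => min_le_right _ _)
        (intervalIntegral.integral_mono_on hs.2 hmin_sb hf_sb fun t _ => min_le_left _ _)
    _ = v * (s - a) + ∫ t in s..b, f t := by
        rw [intervalIntegral.integral_const, smul_eq_mul, mul_comm]

theorem integral_min_const_eq_of_threshold (hf : IntervalIntegrable f volume a b)
    (hs : s ∈ Icc a b) (hle : ∀ t ∈ Ioo a s, v ≤ f t) (hge : ∀ t ∈ Ioo s b, f t ≤ v) :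
    ∫ t in a..b, min (f t) v = v * (s - a) + ∫ t in s..b, f t := by
  have hmin := intervalIntegrable_min_const hf v
  have hs' : s ∈ uIcc a b := Icc_subset_uIcc hs
  calc ∫ t in a..b, min (f t) v
      = (∫ t in a..s, min (f t) v) + ∫ t in s..b, min (f t) v :=
        (intervalIntegral.integral_add_adjacent_intervals
          (hmin.mono_set (uIcc_subset_uIcc_left hs'))
          (hmin.mono_set (uIcc_subset_uIcc_right hs'))).symm
    _ = (∫ _ in a..s, v) + ∫ t in s..b, f t := congrArg₂ _
        (intervalIntegral.integral_congr_Ioo_of_le hs.1 fun t ht => min_eq_right (hle t ht))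
        (intervalIntegral.integral_congr_Ioo_of_le hs.2 fun t ht => min_eq_left (hge t ht))
    _ = v * (s - a) + ∫ t in s..b, f t := by
        rw [intervalIntegral.integral_const, smul_eq_mul, mul_comm]

end Majorization

/-- The survival function `y ↦ λ {s ∈ (0,1) | y < f s}` of `f` under Lebesgue measure on `(0,1)`.
It is the generalized inverse of `decRearrangement f`. -/
noncomputable def survival (f : ℝ → ℝ) (y : ℝ) : ℝ :=
  volume.real {s ∈ Ioo (0 : ℝ) 1 | y < f s}

theorem survival_eq_restrict (f : ℝ → ℝ) (y : ℝ) :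
    survival f y = (volume.restrict (Ioo (0 : ℝ) 1)).real {s | y < f s} := by
  rw [measureReal_restrict_apply' measurableSet_Ioo, inter_comm]
  rfl

theorem decRearrangement_eq_sInf_survival (f : ℝ → ℝ) (t : ℝ) :
    decRearrangement f t = sInf {y | 0 ≤ y ∧ survival f y ≤ t} := rfl

theorem survival_antitone (f : ℝ → ℝ) : Antitone (survival f) := fun y z hyz => by
  rw [survival_eq_restrict, survival_eq_restrict]
  exact measureReal_mono fun s hs => hyz.trans_lt hs

theorem survival_mem_Icc (f : ℝ → ℝ) (y : ℝ) : survival f y ∈ Icc (0 : ℝ) 1 := by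
  rw [survival_eq_restrict]
  exact ⟨measureReal_nonneg, (measureReal_mono (subset_univ _)).trans_eq (by simp)⟩

theorem intervalIntegrable_survival (f : ℝ → ℝ) (a b : ℝ) :
    IntervalIntegrable (survival f) volume a b :=
  (survival_antitone f).intervalIntegrable

theorem integral_survival_mem_Icc (f : ℝ → ℝ) {a b : ℝ} (hab : a ≤ b) :
    ∫ y in a..b, survival f y ∈ Icc 0 (b - a) := by
  refine ⟨intervalIntegral.integral_nonneg hab fun y _ => (survival_mem_Icc f y).1, ?_⟩
  calc ∫ y in a..b, survival f y ≤ ∫ _ in a..b, (1 : ℝ) :=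
        intervalIntegral.integral_mono_on hab (intervalIntegrable_survival f a b)
          intervalIntegrable_const fun y _ => (survival_mem_Icc f y).2
    _ = b - a := by simp

theorem survival_congr_ae {f g : ℝ → ℝ} (h : f =ᵐ[volume.restrict (Ioo (0 : ℝ) 1)] g) :
    survival f = survival g := by
  ext y
  rw [survival_eq_restrict, survival_eq_restrict]
  refine measureReal_congr ?_
  filter_upwards [h] with s hs
  exact congrArg (y < ·) hs

theorem decRearrangement_congr_ae {f g : ℝ → ℝ}
    (h : f =ᵐ[volume.restrict (Ioo (0 : ℝ) 1)] g) : decRearrangement f = decRearrangement g := by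
  ext t
  simp only [decRearrangement_eq_sInf_survival, survival_congr_ae h]

theorem integral_min_const_eq_integral_survival {f : ℝ → ℝ}
    (hfm : AEMeasurable f (volume.restrict (Ioo (0 : ℝ) 1)))
    (hf : MapsTo f (Ioo 0 1) (Ici 0)) {v : ℝ} (hv : 0 ≤ v) :
    ∫ t in (0 : ℝ)..1, min (f t) v = ∫ y in (0 : ℝ)..v, survival f y := by
  simp only [intervalIntegral_eq_setIntegral_Ioo _ zero_le_one, survival_eq_restrict]
  exact integral_min_const_eq_integral_measureReal_lt hfm
    ((ae_restrict_mem measurableSet_Ioo).mono hf) hv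

theorem integral_min_one {f : ℝ → ℝ} (hf : MapsTo f (Ioo 0 1) (Iic 1)) :
    ∫ t in (0 : ℝ)..1, min (f t) 1 = ∫ t in (0 : ℝ)..1, f t :=
  intervalIntegral.integral_congr_Ioo_of_le zero_le_one fun _ ht => min_eq_left (hf ht)

theorem intervalIntegrable_of_mapsTo_Icc {f : ℝ → ℝ} {c d : ℝ}
    (hfm : AEMeasurable f (volume.restrict (Ioo (0 : ℝ) 1))) (hf : MapsTo f (Ioo 0 1) (Icc c d)) :
    IntervalIntegrable f volume 0 1 := by
  rw [intervalIntegrable_iff_integrableOn_Ioo_of_le zero_le_one]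
  exact .of_mem_Icc c d hfm ((ae_restrict_mem measurableSet_Ioo).mono hf)

section AntitoneOn

variable {p q : ℝ → ℝ} {t y : ℝ}

theorem le_survival_of_antitoneOn (hp : AntitoneOn p (Ioo 0 1)) (ht : t ∈ Ioo (0 : ℝ) 1)
    (hy : y < p t) : t ≤ survival p y := by
  calc t = volume.real (Ioc 0 t) := by simp [ht.1.le]
    _ ≤ survival p y := by
      refine measureReal_mono (fun s hs => ?_) (measure_ne_top_of_subset (sep_subset _ _) (by simp))
      have hs' : s ∈ Ioo (0 : ℝ) 1 := ⟨hs.1, hs.2.trans_lt ht.2⟩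
      exact ⟨hs', hy.trans_le (hp hs' ht hs.2)⟩

theorem survival_le_of_antitoneOn (hp : AntitoneOn p (Ioo 0 1)) (ht : t ∈ Ioo (0 : ℝ) 1)
    (hy : p t ≤ y) : survival p y ≤ t := by
  calc survival p y ≤ volume.real (Ioo 0 t) :=
        measureReal_mono (fun s hs => ⟨hs.1.1, hp.reflect_lt ht hs.1 (hy.trans_lt hs.2)⟩) (by simp)
    _ = t := by simp [ht.1.le]

/-- The two sides are related by the duality
`∫₀¹ min (p t) v dt = inf_s (v * s + ∫_s^1 p)`, where the infimum is attained where `p` crosses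
the level `v`. -/
theorem forall_integral_le_iff_forall_integral_min_le {V : Set ℝ} (hp : AntitoneOn p (Ioo 0 1))
    (hq : AntitoneOn q (Ioo 0 1)) (hpi : IntervalIntegrable p volume 0 1)
    (hqi : IntervalIntegrable q volume 0 1) (hqV : MapsTo q (Ioo 0 1) V)
    (hpq : ∫ t in (0 : ℝ)..1, p t = ∫ t in (0 : ℝ)..1, q t) :
    (∀ s ∈ Icc (0 : ℝ) 1, ∫ t in (0 : ℝ)..s, p t ≤ ∫ t in (0 : ℝ)..s, q t) ↔
      ∀ v ∈ V, ∫ t in (0 : ℝ)..1, min (q t) v ≤ ∫ t in (0 : ℝ)..1, min (p t) v := by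
  constructor
  · intro h v _
    have hs := survival_mem_Icc p v
    calc ∫ t in (0 : ℝ)..1, min (q t) v
        ≤ v * (survival p v - 0) + ∫ t in survival p v..1, q t := integral_min_const_le hqi hs v
      _ ≤ v * (survival p v - 0) + ∫ t in survival p v..1, p t := by
        gcongr
        exact (head_integral_le_iff_tail_integral_le hpi hqi hs hpq).1 (h _ hs)
      _ = ∫ t in (0 : ℝ)..1, min (p t) v := by
        refine (integral_min_const_eq_of_threshold hpi hs (fun t ht => ?_) fun t ht => ?_).symm
        · by_contra! htv
          exact ht.2.not_ge (survival_le_of_antitoneOn hp ⟨ht.1, ht.2.trans_le hs.2⟩ htv.le)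
        · by_contra! hvt
          exact ht.1.not_ge (le_survival_of_antitoneOn hp ⟨hs.1.trans_lt ht.1, ht.2⟩ hvt)
  · intro h
    refine (forall_mem_Icc_integral_le_iff_forall_mem_Ioo hpq).2 fun s hs => ?_
    have hs' := Ioo_subset_Icc_self hs
    refine (head_integral_le_iff_tail_integral_le hpi hqi hs' hpq).2
      (le_of_add_le_add_left (a := q s * (s - 0)) ?_)
    calc q s * (s - 0) + ∫ t in s..1, q t
        = ∫ t in (0 : ℝ)..1, min (q t) (q s) :=
          (integral_min_const_eq_of_threshold hqi hs'
            (fun t ht => hq ⟨ht.1, ht.2.trans hs.2⟩ hs ht.2.le)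
            (fun t ht => hq hs ⟨hs.1.trans ht.1, ht.2⟩ ht.1.le)).symm
      _ ≤ ∫ t in (0 : ℝ)..1, min (p t) (q s) := h _ (hqV hs)
      _ ≤ q s * (s - 0) + ∫ t in s..1, p t := integral_min_const_le hpi hs' _

theorem decRearrangement_eq_of_continuousAt (hp : AntitoneOn p (Ioo 0 1))
    (ht : t ∈ Ioo (0 : ℝ) 1) (h0 : 0 ≤ p t) (hc : ContinuousAt p t) :
    decRearrangement p t = p t := by
  refine IsLeast.csInf_eq ⟨⟨h0, survival_le_of_antitoneOn hp ht le_rfl⟩, fun y hy => ?_⟩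
  by_contra! hyt
  obtain ⟨r, hyr, hr⟩ : ∃ r, y < p r ∧ r ∈ Ioo t 1 :=
    (((hc.eventually_const_lt hyt).filter_mono nhdsWithin_le_nhds).and
      (Ioo_mem_nhdsGT ht.2)).exists
  have hr_le : r ≤ survival p y := le_survival_of_antitoneOn hp ⟨ht.1.trans hr.1, hr.2⟩ hyr
  exact hr.1.not_ge (hr_le.trans hy.2)

theorem decRearrangement_ae_eq_of_antitoneOn (hp : AntitoneOn p (Ioo 0 1))
    (h0 : MapsTo p (Ioo 0 1) (Ici 0)) :
    decRearrangement p =ᵐ[volume.restrict (Ioo (0 : ℝ) 1)] p := by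
  filter_upwards [ae_restrict_mem measurableSet_Ioo,
    hp.countable_not_continuousWithinAt.ae_notMem _] with t ht htc
  have hc : ContinuousWithinAt p (Ioo 0 1) t := by_contra fun h => htc ⟨ht, h⟩
  exact decRearrangement_eq_of_continuousAt hp ht (h0 ht) (hc.continuousAt (Ioo_mem_nhds ht.1 ht.2))

end AntitoneOn

section Rearrangement

variable {f g : ℝ → ℝ}

theorem mapsTo_decRearrangement (hf : MapsTo f (Ioo 0 1) (Icc 0 1)) :
    MapsTo (decRearrangement f) (Ioo 0 1) (Icc 0 1) := fun t ht => by
  have hempty : {s ∈ Ioo (0 : ℝ) 1 | 1 < f s} = ∅ :=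
    sep_eq_empty_iff_mem_false.2 fun s hs => (hf hs).2.not_gt
  refine ⟨Real.sInf_nonneg fun y hy => hy.1, csInf_le ⟨0, fun y hy => hy.1⟩ ⟨zero_le_one, ?_⟩⟩
  rw [hempty, measureReal_empty]
  exact ht.1.le

theorem identDistrib_decRearrangement (hfm : Measurable f) (hf : MapsTo f (Ioo 0 1) (Icc 0 1)) :
    IdentDistrib (decRearrangement f) f (volume.restrict (Ioo 0 1))
      (volume.restrict (Ioo 0 1)) := by
  obtain ⟨hanti, hdistr⟩ := decRearrangement_spec f hfm hf
  have hm : AEMeasurable (decRearrangement f) (volume.restrict (Ioo (0 : ℝ) 1)) :=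
    aemeasurable_restrict_of_antitoneOn measurableSet_Ioo hanti
  refine ⟨hm, hfm.aemeasurable, Measure.ext_of_Iic _ _ fun y => ?_⟩
  have map_Iic {g : ℝ → ℝ} (hg : AEMeasurable g (volume.restrict (Ioo (0 : ℝ) 1))) :
      (volume.restrict (Ioo (0 : ℝ) 1)).map g (Iic y) = volume {t ∈ Ioo (0 : ℝ) 1 | g t ≤ y} := by
    rw [Measure.map_apply_of_aemeasurable hg measurableSet_Iic,
      Measure.restrict_apply' measurableSet_Ioo, inter_comm]
    rfl
  rw [map_Iic hm, map_Iic hfm.aemeasurable]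
  have hf' := mapsTo_decRearrangement hf
  rcases lt_or_ge y 0 with hy0 | hy0
  · rw [sep_eq_empty_iff_mem_false.2 fun t ht => (hy0.trans_le (hf' ht).1).not_ge,
      sep_eq_empty_iff_mem_false.2 fun t ht => (hy0.trans_le (hf ht).1).not_ge]
  rcases le_or_gt y 1 with hy1 | hy1
  · exact hdistr y ⟨hy0, hy1⟩
  · rw [sep_eq_self_iff_mem_true.2 fun t ht => (hf' ht).2.trans hy1.le,
      sep_eq_self_iff_mem_true.2 fun t ht => (hf ht).2.trans hy1.le]

theorem integral_comp_decRearrangement (hfm : Measurable f) (hf : MapsTo f (Ioo 0 1) (Icc 0 1))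
    {φ : ℝ → ℝ} (hφ : Measurable φ) :
    ∫ t in (0 : ℝ)..1, φ (decRearrangement f t) = ∫ t in (0 : ℝ)..1, φ (f t) := by
  simp only [intervalIntegral_eq_setIntegral_Ioo _ zero_le_one]
  exact ((identDistrib_decRearrangement hfm hf).comp hφ).integral_eq

theorem schurLE_iff_forall_mem_Icc
    (h : ∫ t in (0 : ℝ)..1, decRearrangement f t = ∫ t in (0 : ℝ)..1, decRearrangement g t) :
    SchurLE f g ↔ ∀ v ∈ Icc (0 : ℝ) 1,
      ∫ t in (0 : ℝ)..v, decRearrangement f t ≤ ∫ t in (0 : ℝ)..v, decRearrangement g t := by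
  rw [SchurLE, and_iff_left h]
  exact (forall_mem_Icc_integral_le_iff_forall_mem_Ioo h).symm

theorem schurLE_iff_forall_integral_min_le (hfm : Measurable f)
    (hf : MapsTo f (Ioo 0 1) (Icc 0 1)) (hgm : Measurable g) (hg : MapsTo g (Ioo 0 1) (Icc 0 1))
    (hfg : ∫ t in (0 : ℝ)..1, f t = ∫ t in (0 : ℝ)..1, g t) :
    SchurLE f g ↔ ∀ v ∈ Icc (0 : ℝ) 1,
      ∫ t in (0 : ℝ)..1, min (g t) v ≤ ∫ t in (0 : ℝ)..1, min (f t) v := by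
  have hanti {k : ℝ → ℝ} (hkm : Measurable k) (hk : MapsTo k (Ioo 0 1) (Icc 0 1)) :=
    (decRearrangement_spec k hkm hk).1
  have hint {k : ℝ → ℝ} (hkm : Measurable k) (hk : MapsTo k (Ioo 0 1) (Icc 0 1)) :=
    intervalIntegrable_of_mapsTo_Icc (identDistrib_decRearrangement hkm hk).aemeasurable_fst
      (mapsTo_decRearrangement hk)
  have hfg' : ∫ t in (0 : ℝ)..1, decRearrangement f t = ∫ t in (0 : ℝ)..1, decRearrangement g t :=
    (integral_comp_decRearrangement hfm hf measurable_id).trans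
      (hfg.trans (integral_comp_decRearrangement hgm hg measurable_id).symm)
  rw [schurLE_iff_forall_mem_Icc hfg', forall_integral_le_iff_forall_integral_min_le
    (hanti hfm hf) (hanti hgm hg) (hint hfm hf) (hint hgm hg) (mapsTo_decRearrangement hg) hfg']
  refine forall₂_congr fun v _ => ?_
  have hmin : Measurable fun y : ℝ => min y v := measurable_id.min measurable_const
  rw [integral_comp_decRearrangement hfm hf hmin, integral_comp_decRearrangement hgm hg hmin]

end Rearrangement

/-- The property of copulas on which the upper product transform depends: each section `C u` with
`u ∈ [0,1]` increases from `0` to `u` on `[0,1]` and is `1`-Lipschitz there. Monotonicity and the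
Lipschitz bound are combined into one bound on increments; nothing relates different sections. -/
structure HasCopulaSections (C : ℝ → ℝ → ℝ) : Prop where
  zero_right : ∀ u ∈ Icc (0 : ℝ) 1, C u 0 = 0
  one_right : ∀ u ∈ Icc (0 : ℝ) 1, C u 1 = u
  sub_mem_Icc : ∀ u ∈ Icc (0 : ℝ) 1, ∀ s ∈ Icc (0 : ℝ) 1, ∀ t ∈ Icc (0 : ℝ) 1, s ≤ t →
    C u t - C u s ∈ Icc 0 (t - s)

theorem IsCopula.hasCopulaSections {C : ℝ → ℝ → ℝ} (hC : IsCopula C) : HasCopulaSections C where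
  zero_right := hC.zero_right
  one_right := hC.one_right
  sub_mem_Icc u hu s hs t ht hst := by
    have h0 := hC.two_increasing 0 (left_mem_Icc.2 zero_le_one) u hu s hs t ht hu.1 hst
    have h1 := hC.two_increasing u hu 1 (right_mem_Icc.2 zero_le_one) s hs t ht hu.2 hst
    rw [hC.zero_left s hs, hC.zero_left t ht] at h0
    rw [hC.one_left s hs, hC.one_left t ht] at h1
    constructor <;> linarith

theorem partialTwo_indepCopula (v t : ℝ) : partialTwo indepCopula v t = v := by
  have hlin : indepCopula v = fun t => v * t := rfl
  simp [partialTwo, hlin]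

theorem upperTransform_apply (C : ℝ → ℝ → ℝ) (u v : ℝ) :
    upperTransform C u v = ∫ t in (0 : ℝ)..1, min (partialTwo C u t) v := by
  simp only [upperTransform, upperProduct, partialTwo_indepCopula]

theorem measurable_partialTwo (C : ℝ → ℝ → ℝ) (u : ℝ) : Measurable (partialTwo C u) :=
  measurable_deriv (C u)

namespace HasCopulaSections

variable {C D E : ℝ → ℝ → ℝ} {u v : ℝ}

theorem zero_left (hC : HasCopulaSections C) (hv : v ∈ Icc (0 : ℝ) 1) : C 0 v = 0 := by
  have h0 : (0 : ℝ) ∈ Icc (0 : ℝ) 1 := left_mem_Icc.2 zero_le_one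
  have h1 : (1 : ℝ) ∈ Icc (0 : ℝ) 1 := right_mem_Icc.2 zero_le_one
  linarith [(hC.sub_mem_Icc 0 h0 0 h0 v hv hv.1).1, (hC.sub_mem_Icc 0 h0 v hv 1 h1 hv.2).1,
    hC.zero_right 0 h0, hC.one_right 0 h0]

theorem one_left (hC : HasCopulaSections C) (hv : v ∈ Icc (0 : ℝ) 1) : C 1 v = v := by
  have h0 : (0 : ℝ) ∈ Icc (0 : ℝ) 1 := left_mem_Icc.2 zero_le_one
  have h1 : (1 : ℝ) ∈ Icc (0 : ℝ) 1 := right_mem_Icc.2 zero_le_one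
  linarith [(hC.sub_mem_Icc 1 h1 0 h0 v hv hv.1).2, (hC.sub_mem_Icc 1 h1 v hv 1 h1 hv.2).2,
    hC.zero_right 1 h1, hC.one_right 1 h1]

theorem monotoneOn (hC : HasCopulaSections C) (hu : u ∈ Icc (0 : ℝ) 1) :
    MonotoneOn (C u) (Icc 0 1) := fun s hs t ht hst =>
  sub_nonneg.1 (hC.sub_mem_Icc u hu s hs t ht hst).1

theorem lipschitzOnWith (hC : HasCopulaSections C) (hu : u ∈ Icc (0 : ℝ) 1) :
    LipschitzOnWith 1 (C u) (Icc 0 1) := by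
  refine LipschitzOnWith.of_le_add fun t ht s hs => ?_
  rcases le_total s t with hst | hts
  · have hincr := (hC.sub_mem_Icc u hu s hs t ht hst).2
    linarith [Real.dist_eq t s, le_abs_self (t - s)]
  · exact (hC.monotoneOn hu ht hs hts).trans (le_add_of_nonneg_right dist_nonneg)

theorem mapsTo_partialTwo (hC : HasCopulaSections C) (hu : u ∈ Icc (0 : ℝ) 1) :
    MapsTo (partialTwo C u) (Ioo 0 1) (Icc 0 1) := fun t ht => by
  have hnhds : Icc (0 : ℝ) 1 ∈ nhds t := Icc_mem_nhds ht.1 ht.2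
  constructor
  · rw [partialTwo, ← derivWithin_of_mem_nhds hnhds]
    exact (hC.monotoneOn hu).derivWithin_nonneg
  · exact (Real.le_norm_self _).trans (norm_deriv_le_of_lipschitzOn hnhds (hC.lipschitzOnWith hu))

theorem integral_partialTwo (hC : HasCopulaSections C) (hu : u ∈ Icc (0 : ℝ) 1) :
    ∫ t in (0 : ℝ)..1, partialTwo C u t = u := by
  have hac : AbsolutelyContinuousOnInterval (C u) 0 1 :=
    LipschitzOnWith.absolutelyContinuousOnInterval
      (by simpa only [uIcc_of_le zero_le_one] using hC.lipschitzOnWith hu)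
  calc ∫ t in (0 : ℝ)..1, partialTwo C u t = C u 1 - C u 0 := hac.integral_deriv_eq_sub
    _ = u := by rw [hC.one_right u hu, hC.zero_right u hu, sub_zero]

theorem upperTransform_eq_integral_survival (hC : HasCopulaSections C) (hu : u ∈ Icc (0 : ℝ) 1)
    (hv : 0 ≤ v) : upperTransform C u v = ∫ y in (0 : ℝ)..v, survival (partialTwo C u) y := by
  rw [upperTransform_apply, integral_min_const_eq_integral_survival
    (measurable_partialTwo C u).aemeasurable
    ((hC.mapsTo_partialTwo hu).mono_right Icc_subset_Ici_self) hv]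

theorem hasCopulaSections_upperTransform (hC : HasCopulaSections C) :
    HasCopulaSections (upperTransform C) where
  zero_right u hu := by
    rw [hC.upperTransform_eq_integral_survival hu le_rfl, intervalIntegral.integral_same]
  one_right u hu := by
    rw [upperTransform_apply,
      integral_min_one ((hC.mapsTo_partialTwo hu).mono_right Icc_subset_Iic_self),
      hC.integral_partialTwo hu]
  sub_mem_Icc u hu s hs t ht hst := by
    rw [hC.upperTransform_eq_integral_survival hu hs.1,
      hC.upperTransform_eq_integral_survival hu ht.1, intervalIntegral.integral_interval_sub_left
        (intervalIntegrable_survival _ _ _) (intervalIntegrable_survival _ _ _)]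
    exact integral_survival_mem_Icc _ hst

theorem partialTwo_upperTransform_ae_eq (hC : HasCopulaSections C) (hu : u ∈ Icc (0 : ℝ) 1) :
    partialTwo (upperTransform C) u =ᵐ[volume.restrict (Ioo (0 : ℝ) 1)]
      survival (partialTwo C u) := by
  filter_upwards [ae_restrict_mem measurableSet_Ioo, ae_restrict_of_ae
    (intervalIntegrable_survival (partialTwo C u) 0 1).ae_hasDerivAt_integral] with t ht hderiv
  have heq : upperTransform C u =ᶠ[nhds t]
      fun v => ∫ y in (0 : ℝ)..v, survival (partialTwo C u) y := by
    filter_upwards [Ioi_mem_nhds ht.1] with v hv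
    exact hC.upperTransform_eq_integral_survival hu hv.le
  exact ((hderiv (Icc_subset_uIcc (Ioo_subset_Icc_self ht)) 0 left_mem_uIcc).congr_of_eventuallyEq
    heq).deriv

theorem integral_decRearrangement_partialTwo_upperTransform (hC : HasCopulaSections C)
    (hu : u ∈ Icc (0 : ℝ) 1) (hv : v ∈ Icc (0 : ℝ) 1) :
    ∫ t in (0 : ℝ)..v, decRearrangement (partialTwo (upperTransform C) u) t =
      upperTransform C u v := by
  have hdec : decRearrangement (survival (partialTwo C u)) =ᵐ[volume.restrict (Ioo (0 : ℝ) v)]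
      survival (partialTwo C u) :=
    ae_restrict_of_ae_restrict_of_subset (Ioo_subset_Ioo_right hv.2)
      (decRearrangement_ae_eq_of_antitoneOn ((survival_antitone _).antitoneOn _)
        fun y _ => (survival_mem_Icc _ y).1)
  rw [decRearrangement_congr_ae (hC.partialTwo_upperTransform_ae_eq hu),
    hC.upperTransform_eq_integral_survival hu hv.1, intervalIntegral_eq_setIntegral_Ioo _ hv.1,
    intervalIntegral_eq_setIntegral_Ioo _ hv.1, integral_congr_ae hdec]

theorem lowerOrthantLE_iff (hD : HasCopulaSections D) (hE : HasCopulaSections E) :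
    LowerOrthantLE D E ↔ ∀ u ∈ Ioo (0 : ℝ) 1, ∀ v ∈ Icc (0 : ℝ) 1, D u v ≤ E u v :=
  forall_mem_Icc_iff_forall_mem_Ioo
    (fun v hv => by rw [hD.zero_left hv, hE.zero_left hv])
    (fun v hv => by rw [hD.one_left hv, hE.one_left hv])

theorem derivSchurLE_iff_lowerOrthantLE_upperTransform (hD : HasCopulaSections D)
    (hE : HasCopulaSections E) :
    DerivSchurLE D E ↔ LowerOrthantLE (upperTransform E) (upperTransform D) := by
  rw [hE.hasCopulaSections_upperTransform.lowerOrthantLE_iff hD.hasCopulaSections_upperTransform]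
  refine forall₂_congr fun u hu => ?_
  replace hu := Ioo_subset_Icc_self hu
  simp only [upperTransform_apply]
  exact schurLE_iff_forall_integral_min_le (measurable_partialTwo D u) (hD.mapsTo_partialTwo hu)
    (measurable_partialTwo E u) (hE.mapsTo_partialTwo hu)
    ((hD.integral_partialTwo hu).trans (hE.integral_partialTwo hu).symm)

theorem derivSchurLE_upperTransform_iff_lowerOrthantLE (hD : HasCopulaSections D)
    (hE : HasCopulaSections E) :
    DerivSchurLE (upperTransform D) (upperTransform E) ↔
      LowerOrthantLE (upperTransform D) (upperTransform E) := by
  have hTD := hD.hasCopulaSections_upperTransform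
  have hTE := hE.hasCopulaSections_upperTransform
  rw [hTD.lowerOrthantLE_iff hTE]
  refine forall₂_congr fun u hu => ?_
  replace hu := Ioo_subset_Icc_self hu
  have h1 : (1 : ℝ) ∈ Icc (0 : ℝ) 1 := right_mem_Icc.2 zero_le_one
  rw [schurLE_iff_forall_mem_Icc
    (by rw [hD.integral_decRearrangement_partialTwo_upperTransform hu h1,
      hE.integral_decRearrangement_partialTwo_upperTransform hu h1, hTD.one_right u hu,
      hTE.one_right u hu])]
  refine forall₂_congr fun v hv => ?_
  rw [hD.integral_decRearrangement_partialTwo_upperTransform hu hv,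
    hE.integral_decRearrangement_partialTwo_upperTransform hu hv]

end HasCopulaSections

theorem theorem5p1_general (D E : ℝ → ℝ → ℝ) (hD : HasCopulaSections D)
    (hE : HasCopulaSections E) :
    List.TFAE [
      DerivSchurLE D E,
      LowerOrthantLE (upperTransform E) (upperTransform D),
      DerivSchurLE (upperTransform E) (upperTransform D),
      LowerOrthantLE (upperTransform^[2] D) (upperTransform^[2] E),
      DerivSchurLE (upperTransform^[2] D) (upperTransform^[2] E)] := by
  have hTD := hD.hasCopulaSections_upperTransform
  have hTE := hE.hasCopulaSections_upperTransform
  simp only [Function.iterate_succ, Function.iterate_zero, Function.comp_apply, id_eq]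
  tfae_have 1 ↔ 2 := hD.derivSchurLE_iff_lowerOrthantLE_upperTransform hE
  tfae_have 3 ↔ 2 := hE.derivSchurLE_upperTransform_iff_lowerOrthantLE hD
  tfae_have 3 ↔ 4 := hTE.derivSchurLE_iff_lowerOrthantLE_upperTransform hTD
  tfae_have 5 ↔ 4 := hTD.derivSchurLE_upperTransform_iff_lowerOrthantLE hTE
  tfae_finish

theorem theorem5p1 (D E : ℝ → ℝ → ℝ) (hD : IsCopula D) (hE : IsCopula E) :
    List.TFAE [
      DerivSchurLE D E,
      LowerOrthantLE (upperTransform E) (upperTransform D),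
      DerivSchurLE (upperTransform E) (upperTransform D),
      LowerOrthantLE (upperTransform^[2] D) (upperTransform^[2] E),
      DerivSchurLE (upperTransform^[2] D) (upperTransform^[2] E)] :=
  theorem5p1_general D E hD.hasCopulaSections hE.hasCopulaSections
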